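/- Let $1\le\lambda\le w$ be integers. At an origin, $w$ half-lines (paths) start; a goal lies on one of the paths at an unknown distance $n>0$ from the origin. There are $\lambda$ robots, initially at the origin. A deterministic exploration algorithm prescribes for each robot a continuous trajectory on the paths, starting at the origin, that is followed until some robot stands at the goal; the distance travelled by a robot is the length of its trajectory. Let $\mathrm{cost}(n)\in[0,\infty]$ be the supremum, over the $w$ paths, of the total distance travelled by all the robots until the goal is found, when the goal is at distance $n$ on that path ($\infty$ if it is never found). The algorithm has competitive ratio $c\in\mathbb R$ if $\mathrm{cost}(n)\le c\,n+o(n)$, that is, if there is a function $g:\mathbb R\to\mathbb R$ with $g(n)/n\to0$ as $n\to\infty$ such that $\mathrm{cost}(n)\le c\,n+g(n)$ for all real $n>0$. Let $D(w,\lambda)$ be the smallest $c$ such that some deterministic exploration algorithm for $w$ paths and $\lambda$ robots has competitive ratio $c$. Then this minimum exists. If $\lambda<w$, then $$D(w,\lambda)=\lambda+2\,\frac{(w-\lambda+1)^{w-\lambda+1}}{(w-\lambda)^{w-\lambda}},$$ and if $\lambda=w$, then $D(w,w)=w$. -/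

import Mathlib

open scoped NNReal ENNReal

/-- The environment: `w` half-lines (the paths, labelled by `Fin w`) glued at a common origin.
A point is coded by its vector of distances along the paths: all entries are nonnegative and at
most one is nonzero. With the `ℓ¹` metric of the ambient space, the distance between the points at
distances `a`, `b` from the origin is `|a - b|` if they lie on the same path and `a + b` otherwise,
which is the distance walked along the paths. -/
def pathStar (w : ℕ) : Set (PiLp 1 (fun _ : Fin w => ℝ)) :=
  {x | (∀ p, 0 ≤ x p) ∧ ∀ p q, x p ≠ 0 → x q ≠ 0 → p = q}

/-- A deterministic exploration algorithm for `w` paths and `l` robots. As long as the goal is not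
found the robots receive no information, so the algorithm is the family of the trajectories that
the robots follow until then: continuous motions on the paths that start at the origin. -/
structure ExplorationAlgorithm (w l : ℕ) where
  /-- the position of a robot at a time -/
  position : Fin l → ℝ≥0 → PiLp 1 (fun _ : Fin w => ℝ)
  position_mem_star : ∀ k t, position k t ∈ pathStar w
  position_zero : ∀ k, position k 0 = 0
  continuous_position : ∀ k, Continuous (position k)

namespace ExplorationAlgorithm

variable {w l : ℕ}

/-- The total distance travelled by all the robots up to time `t` (the sum of the lengths of their
trajectories). -/
noncomputable def travelled (A : ExplorationAlgorithm w l) (t : ℝ≥0) : ℝ≥0∞ :=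
  ∑ k, eVariationOn (A.position k) (Set.Iic t)

/-- At time `t`, some robot stands on path `p` at distance `n` from the origin. -/
def Reaches (A : ExplorationAlgorithm w l) (p : Fin w) (n : ℝ) (t : ℝ≥0) : Prop :=
  ∃ k, A.position k t p = n

/-- The total distance travelled by all the robots until the goal is found, if it lies on path `p`
at distance `n`; it is `∞` if the goal is never found. The distance travelled is monotone in time
and the set of times at which a robot stands at the goal is closed, so the infimum is the distance
travelled up to the first such time. -/
noncomputable def goalCost (A : ExplorationAlgorithm w l) (p : Fin w) (n : ℝ) : ℝ≥0∞ :=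
  ⨅ (t : ℝ≥0) (_ : A.Reaches p n t), A.travelled t

/-- The worst-case total distance travelled when the goal is at distance `n`. -/
noncomputable def cost (A : ExplorationAlgorithm w l) (n : ℝ) : ℝ≥0∞ :=
  ⨆ p, A.goalCost p n

/-- `A` has competitive ratio `c` if its cost is at most `c * n + o(n)`. -/
def HasCompetitiveRatio (A : ExplorationAlgorithm w l) (c : ℝ) : Prop :=
  ∃ g : ℝ → ℝ, g =o[Filter.atTop] (fun n : ℝ => n) ∧
    ∀ n : ℝ, 0 < n → A.cost n ≤ ENNReal.ofReal (c * n + g n)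

end ExplorationAlgorithm

/-- The competitive ratios of deterministic exploration algorithms for `w` paths, `l` robots. -/
def competitiveRatios (w l : ℕ) : Set ℝ :=
  {c | ∃ A : ExplorationAlgorithm w l, A.HasCompetitiveRatio c}

/-! Lower bound. Between visits to the origin a robot stays on one path, so its motion splits into
excursions. When all paths have been explored up to `v`, each path has its own excursion of height
at least `v`. A finished excursion costs at least twice its height, a current one at least its peak.
Put `m = w - l`, let the cost be at most `(2 * C + l) * v`, and let `D` robots have a current peak
below `v`. Then at least `m + D` finished excursions have height at least `v`, and twice the sum of
the finished heights is at most `(2 * C + D) * v` (`exists_card_add_le_and_sum_le`). Dropping `D`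
high excursions absorbs the term in `D`. Hence the sorted heights satisfy `z 0 + ⋯ + z (k + m) ≤ C *
z k` for large `k` (`pow_div_pow_le_of_excursions`). If `β` is the infimum of the ratios of
consecutive partial sums, this gives `β ^ (m + 1) ≤ C * (β - 1)`, and Bernoulli's inequality bounds
`C` from below.

Upper bound. One robot visits `m + 1` paths cyclically with turning points growing by the factor `(m
+ 1) / m`, the equality case of Bernoulli; the other robots advance on private paths at the pace of
the exploration. For `l = w` every robot has a private path. -/

/-! ### Inequalities for sequences of heights -/

/-- The minimum of `β ^ (m + 1) / (β - 1)` over `β > 1` is attained at `β = (m + 1) / m`. -/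
theorem pow_div_pow_le_of_pow_le {m : ℕ} (hm : 1 ≤ m) {β C : ℝ} (hβ : 1 < β)
    (h : β ^ (m + 1) ≤ C * (β - 1)) : ((m : ℝ) + 1) ^ (m + 1) / (m : ℝ) ^ m ≤ C := by
  have hm0 : (0 : ℝ) < m := by exact_mod_cast hm
  -- The relative deviation of `β` from the minimiser `(m + 1) / m`; Bernoulli for `1 + y` is then
  -- the claim up to scaling.
  set y : ℝ := β * m / (m + 1) - 1 with hy
  have hβy : β = (m + 1) / m * (1 + y) := by rw [hy]; field_simp; ring
  have hy2 : -2 ≤ y := by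
    have : 0 ≤ β * m / (m + 1) := by positivity
    linarith
  have hb := one_add_mul_le_pow hy2 (m + 1)
  have h1 : 1 + ((m + 1 : ℕ) : ℝ) * y = m * (β - 1) := by
    rw [hy]; push_cast; field_simp; ring
  rw [h1] at hb
  have h2 : ((m : ℝ) + 1) ^ (m + 1) / (m : ℝ) ^ m * (β - 1) ≤ β ^ (m + 1) := by
    calc ((m : ℝ) + 1) ^ (m + 1) / (m : ℝ) ^ m * (β - 1)
        = (((m : ℝ) + 1) / m) ^ (m + 1) * (m * (β - 1)) := by
          rw [div_pow, pow_succ (m : ℝ) m]; field_simp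
      _ ≤ (((m : ℝ) + 1) / m) ^ (m + 1) * (1 + y) ^ (m + 1) := by gcongr
      _ = β ^ (m + 1) := by rw [← mul_pow, ← hβy]
  exact le_of_mul_le_mul_right (h2.trans h) (by linarith)

/-- A positive sequence whose partial sums satisfy `z 0 + ⋯ + z (k + m) ≤ C * z k` for large `k`
forces `C` to be at least `(m + 1) ^ (m + 1) / m ^ m`. -/
theorem pow_div_pow_le_of_sum_le {m : ℕ} (hm : 1 ≤ m) {C : ℝ} {z : ℕ → ℝ} (hz : ∀ k, 0 < z k)
    {K : ℕ} (h : ∀ k, K ≤ k → ∑ j ∈ Finset.range (k + m + 1), z j ≤ C * z k) :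
    ((m : ℝ) + 1) ^ (m + 1) / (m : ℝ) ^ m ≤ C := by
  set S : ℕ → ℝ := fun k => ∑ j ∈ Finset.range k, z j with hS
  have hSs : ∀ k, S (k + 1) = S k + z k := fun k => Finset.sum_range_succ _ _
  have hSpos : ∀ k, K + 1 ≤ k → 0 < S k := fun k hk =>
    Finset.sum_pos (fun j _ => hz j) ⟨0, by simp; omega⟩
  set R : Set ℝ := (fun k => S (k + 1) / S k) '' Set.Ici (K + 1) with hR
  have hRne : R.Nonempty := ⟨_, K + 1, Set.mem_Ici.2 le_rfl, rfl⟩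
  have hR1 : ∀ ρ ∈ R, 1 ≤ ρ := by
    rintro _ ⟨k, hk, rfl⟩
    have := hSpos k hk
    rw [le_div_iff₀ this, hSs]
    linarith [hz k]
  have hbdd : BddBelow R := ⟨1, hR1⟩
  set β := sInf R with hβ
  have hβ1 : 1 ≤ β := le_csInf hRne hR1
  have hstep : ∀ k, K + 1 ≤ k → β * S k ≤ S (k + 1) := fun k hk => by
    rw [← le_div_iff₀ (hSpos k hk)]
    exact csInf_le hbdd ⟨k, hk, rfl⟩
  have hpow : ∀ i k, K + 1 ≤ k → β ^ i * S k ≤ S (k + i) := by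
    intro i k hk
    induction i with
    | zero => simp
    | succ i ih =>
      calc β ^ (i + 1) * S k = β * (β ^ i * S k) := by ring
        _ ≤ β * S (k + i) := by gcongr
        _ ≤ S (k + (i + 1)) := hstep (k + i) (by omega)
  -- From `β ^ m * S (k + 1) ≤ S (k + m + 1) ≤ C * z k`, divided by `S k`. The condition on `ρ` is
  -- closed, so it passes to the infimum `β` even if no ratio attains it.
  have hsub : R ⊆ {ρ | β ^ m * ρ ≤ C * (ρ - 1)} := by
    rintro _ ⟨k, hk, rfl⟩
    have hk : K + 1 ≤ k := hk
    have hpos := hSpos k hk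
    have h1 := hpow m (k + 1) (by omega)
    have h2 := h k (by omega)
    have h3 : S (k + 1 + m) = S (k + m + 1) := by congr 1; omega
    have h4 : z k = S (k + 1) - S k := by rw [hSs]; ring
    rw [h4] at h2
    have h5 : β ^ m * S (k + 1) ≤ C * (S (k + 1) - S k) := by rw [h3] at h1; exact h1.trans h2
    change β ^ m * (S (k + 1) / S k) ≤ C * (S (k + 1) / S k - 1)
    have h6 : C * (S (k + 1) / S k - 1) = C * (S (k + 1) - S k) / S k := by field_simp
    rw [h6, ← mul_div_assoc]
    gcongr
  have hclosed : IsClosed {ρ : ℝ | β ^ m * ρ ≤ C * (ρ - 1)} :=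
    isClosed_le (by fun_prop) (by fun_prop)
  have hmem : β ^ m * β ≤ C * (β - 1) :=
    hclosed.closure_subset_iff.2 hsub (csInf_mem_closure hRne hbdd)
  have hp : 1 ≤ β ^ m * β := by rw [← pow_succ]; exact one_le_pow₀ hβ1
  have hβ1' : 1 < β := by
    rcases hβ1.lt_or_eq with h' | h'
    · exact h'
    · rw [← h'] at hmem hp
      norm_num at hmem
  exact pow_div_pow_le_of_pow_le hm hβ1' (by rw [pow_succ]; exact hmem)

/-- The elements of an infinite set on which `x` has finite sublevel sets can be listed in
increasing order of `x`. -/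
theorem exists_sorted_seq {E : Type*} {x : E → ℝ} {Z : Set E}
    (hfin : ∀ v, {e | e ∈ Z ∧ x e < v}.Finite) (hinf : Z.Infinite) :
    ∃ z : ℕ → ℝ, (∀ k, z k ∈ x '' Z) ∧
      (∀ k v, z k < v → ∃ s : Finset E, s.card = k + 1 ∧ ∀ e ∈ s, e ∈ Z ∧ x e < v) ∧
      ∀ G : Finset E, (∀ e ∈ G, e ∈ Z) → ∑ j ∈ Finset.range G.card, z j ≤ ∑ e ∈ G, x e := by
  classical
  -- Greedy choice of a lowest element outside `s`. It exists because only finitely many elements of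
  -- `Z` lie below `x e₀ + 1`.
  have hpick : ∀ s : Finset E, ∃ e, e ∈ Z ∧ e ∉ s ∧ ∀ f ∈ Z, f ∉ s → x e ≤ x f := by
    intro s
    obtain ⟨e₀, he₀Z, he₀s⟩ := hinf.exists_notMem_finset s
    have hf : {e | e ∈ Z ∧ e ∉ s ∧ x e < x e₀ + 1}.Finite :=
      (hfin (x e₀ + 1)).subset fun e he => ⟨he.1, he.2.2⟩
    obtain ⟨e, he, hmin⟩ := Set.exists_min_image _ x hf ⟨e₀, he₀Z, he₀s, by simp⟩
    refine ⟨e, he.1, he.2.1, fun f hf hfs => ?_⟩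
    by_cases hlt : x f < x e₀ + 1
    · exact hmin f ⟨hf, hfs, hlt⟩
    · linarith [he.2.2]
  choose pick hZ hnot hmin using hpick
  obtain ⟨s, hs0, hs⟩ : ∃ s : ℕ → Finset E, s 0 = ∅ ∧
      ∀ n, s (n + 1) = insert (pick (s n)) (s n) :=
    ⟨fun n => Nat.rec ∅ (fun _ s => insert (pick s) s) n, rfl, fun _ => rfl⟩
  have hsZ : ∀ n, ∀ e ∈ s n, e ∈ Z := by
    intro n
    induction n with
    | zero => intro e he; simp [hs0] at he
    | succ n ih =>
      intro e he
      rw [hs, Finset.mem_insert] at he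
      rcases he with rfl | he
      exacts [hZ _, ih e he]
  have hcard : ∀ n, (s n).card = n := by
    intro n
    induction n with
    | zero => simp [hs0]
    | succ n ih => rw [hs, Finset.card_insert_of_notMem (hnot _), ih]
  have hmono : Monotone fun n => x (pick (s n)) := by
    refine monotone_nat_of_le_succ fun n => hmin _ _ (hZ _) fun hmem => ?_
    have hsub : s n ⊆ s (n + 1) := by rw [hs]; exact Finset.subset_insert _ _
    exact hnot (s (n + 1)) (hsub hmem)
  have hle : ∀ n, ∀ e ∈ s (n + 1), x e ≤ x (pick (s n)) := by
    intro n
    induction n with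
    | zero => intro e he; rw [hs, hs0] at he; simp at he; rw [he, hs0]
    | succ n ih =>
      intro e he
      rw [hs, Finset.mem_insert] at he
      rcases he with rfl | he
      · exact le_rfl
      · exact (ih e he).trans (hmono n.le_succ)
  refine ⟨fun n => x (pick (s n)), fun k => ⟨_, hZ _, rfl⟩, fun k v hv => ?_, fun G hG => ?_⟩
  · exact ⟨s (k + 1), hcard _, fun e he => ⟨hsZ _ e he, (hle k e he).trans_lt hv⟩⟩
  · induction hn : G.card generalizing G with
    | zero => rw [Finset.card_eq_zero] at hn; simp [hn]
    | succ n ih =>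
      -- Such an `e` was available when the `n`-th element was picked, hence is at least as high;
      -- the rest of `G` is handled by induction.
      obtain ⟨e, heG, hes⟩ : ∃ e ∈ G, e ∉ s n :=
        Finset.exists_mem_notMem_of_card_lt_card (by rw [hcard, hn]; omega)
      have h1 := ih (G.erase e) (fun f hf => hG f (Finset.mem_of_mem_erase hf))
        (by rw [Finset.card_erase_of_mem heG, hn]; rfl)
      rw [Finset.sum_range_succ, ← Finset.sum_erase_add _ _ heG]
      exact add_le_add h1 (hmin _ _ (hG e heG) hes)

/-- The combinatorial core of the lower bound. `F v` is the set of the excursions finished when all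
paths have been explored up to `v`, `x e` the height of an excursion, and `D v` the number of
robots that are not beyond `v` in their current excursion. -/
theorem pow_div_pow_le_of_excursions {E : Type*} {x : E → ℝ} {m : ℕ} (hm : 1 ≤ m) {C v₀ : ℝ}
    {F : ℝ → Finset E} {D : ℝ → ℕ} (hF : ∀ v v', v₀ ≤ v → v ≤ v' → F v ⊆ F v')
    (hx : ∀ v, ∀ e ∈ F v, 0 < x e)
    (hcard : ∀ v, v₀ ≤ v → m + D v ≤ ((F v).filter fun e => v ≤ x e).card)
    (hsum : ∀ v, v₀ ≤ v → 2 * ∑ e ∈ F v, x e ≤ (2 * C + D v) * v) :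
    ((m : ℝ) + 1) ^ (m + 1) / (m : ℝ) ^ m ≤ C := by
  classical
  -- The excursions that are finished at every level beyond their own height. By monotonicity of
  -- `F`, those finished at level `v` with height at least `v` belong here (`hbig`).
  set Z : Set E := {e | ∀ v, v₀ ≤ v → x e < v → e ∈ F v} with hZdef
  have hZpos : ∀ e ∈ Z, 0 < x e := fun e he =>
    hx (max v₀ (x e + 1)) e (he _ (le_max_left _ _) (lt_max_of_lt_right (by simp)))
  have hbig : ∀ v, v₀ ≤ v → ∀ e ∈ F v, v ≤ x e → e ∈ Z := fun v hv e he hve v' _ hev' =>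
    hF v v' hv (hve.trans hev'.le) he
  have hfin : ∀ v, {e | e ∈ Z ∧ x e < v}.Finite := fun v =>
    (F (max v v₀)).finite_toSet.subset fun e he =>
      he.1 _ (le_max_right _ _) (lt_max_of_lt_left he.2)
  have hinf : Z.Infinite := by
    intro hZf
    obtain ⟨b, hb⟩ := (hZf.image x).bddAbove
    set v := max v₀ (b + 1)
    have hv : v₀ ≤ v := le_max_left _ _
    obtain ⟨e, he⟩ : ((F v).filter fun e => v ≤ x e).Nonempty := by
      rw [← Finset.card_pos]
      have := hcard v hv
      omega
    rw [Finset.mem_filter] at he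
    have h1 := hb ⟨e, hbig v hv e he.1 he.2, rfl⟩
    have h2 : b + 1 ≤ v := le_max_right _ _
    linarith [he.2]
  obtain ⟨z, hzZ, hzs, hzG⟩ := exists_sorted_seq hfin hinf
  have hzpos : ∀ k, 0 < z k := fun k => by
    obtain ⟨e, he, hek⟩ := hzZ k
    rw [← hek]
    exact hZpos e he
  have hlarge : ∀ k, (hfin v₀).toFinset.card ≤ k → v₀ ≤ z k := by
    intro k hk
    by_contra! hlt
    obtain ⟨s, hsc, hs⟩ := hzs k v₀ hlt
    have : s ⊆ (hfin v₀).toFinset := fun e he => by simpa using hs e he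
    have := Finset.card_le_card this
    omega
  refine pow_div_pow_le_of_sum_le hm hzpos (K := (hfin v₀).toFinset.card) fun k hk => ?_
  have hv₀ := hlarge k hk
  -- At a level strictly above `z k`, the `k + 1` lowest elements are finished and `m` others have
  -- height at least `v`. Letting `v` decrease to `z k` gives the inequality.
  have key : ∀ v, z k < v → ∑ j ∈ Finset.range (k + m + 1), z j ≤ C * v := by
    intro v hv
    have hvv₀ : v₀ ≤ v := hv₀.trans hv.le
    have hvpos : 0 < v := (hzpos k).trans hv
    obtain ⟨s, hsc, hs⟩ := hzs k v hv
    set B := (F v).filter fun e => v ≤ x e with hB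
    have hBc : m + D v ≤ B.card := hcard v hvv₀
    obtain ⟨B', hB'B, hB'c⟩ := Finset.exists_subset_card_eq (show m ≤ B.card by omega)
    have hsB : Disjoint s B := Finset.disjoint_left.2 fun e he heB =>
      absurd (hs e he).2 (not_lt.2 (Finset.mem_filter.1 heB).2)
    have hsB' : Disjoint s B' := hsB.mono_right hB'B
    have hG := hzG (s ∪ B') fun e he => by
      rcases Finset.mem_union.1 he with he | he
      · exact (hs e he).1
      · have := Finset.mem_filter.1 (hB'B he)
        exact hbig v hvv₀ e this.1 this.2
    rw [Finset.card_union_of_disjoint hsB', hsc, hB'c, Finset.sum_union hsB',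
      show k + 1 + m = k + m + 1 by omega] at hG
    have hsub : s ∪ B ⊆ F v := Finset.union_subset
      (fun e he => (hs e he).1 v hvv₀ (hs e he).2) (Finset.filter_subset _ _)
    have h1 : ∑ e ∈ s ∪ B, x e ≤ ∑ e ∈ F v, x e :=
      Finset.sum_le_sum_of_subset_of_nonneg hsub fun e he _ => (hx v e he).le
    rw [Finset.sum_union hsB, ← Finset.sum_sdiff hB'B] at h1
    -- The surplus high excursions contribute at least `D v * v`, more than the extra `D v * v / 2`
    -- that `hsum` allows.
    have h2 : (D v : ℝ) * v ≤ ∑ e ∈ B \ B', x e := by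
      have h3 : (B \ B').card • v ≤ ∑ e ∈ B \ B', x e :=
        Finset.card_nsmul_le_sum _ _ _ fun e he =>
          (Finset.mem_filter.1 (Finset.mem_sdiff.1 he).1).2
      have h4 : D v ≤ (B \ B').card := by
        rw [Finset.card_sdiff_of_subset hB'B]
        omega
      rw [nsmul_eq_mul] at h3
      have h5 : (D v : ℝ) ≤ (B \ B').card := by exact_mod_cast h4
      nlinarith
    have h6 := hsum v hvv₀
    have h7 : 0 ≤ (D v : ℝ) * v := by positivity
    nlinarith
  have hcont : Filter.Tendsto (fun v => C * v) (nhdsWithin (z k) (Set.Ioi (z k)))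
      (nhds (C * z k)) := by
    have : Continuous fun v : ℝ => C * v := by fun_prop
    exact this.continuousWithinAt
  exact ge_of_tendsto hcont (Filter.eventually_of_mem self_mem_nhdsWithin key)

/-! ### Geometry of the paths -/

section Star

variable {w : ℕ}

theorem norm_eq_apply_of_mem_pathStar {x : PiLp 1 (fun _ : Fin w => ℝ)} (hx : x ∈ pathStar w)
    {p : Fin w} (hp : x p ≠ 0) : ‖x‖ = x p := by
  rw [PiLp.norm_eq_of_L1, Finset.sum_eq_single p]
  · exact Real.norm_of_nonneg (hx.1 p)
  · intro q _ hq
    by_contra h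
    exact hq (hx.2 q p (by simpa using h) hp)
  · simp

/-- A motion on the paths that avoids the origin stays on one path. -/
theorem apply_ne_zero_of_forall_ne_zero {f : ℝ≥0 → PiLp 1 (fun _ : Fin w => ℝ)}
    (hf : Continuous f) (hstar : ∀ t, f t ∈ pathStar w) {I : Set ℝ≥0} (hI : I.OrdConnected)
    (h0 : ∀ u ∈ I, f u ≠ 0) {s t : ℝ≥0} (hs : s ∈ I) (ht : t ∈ I) {p : Fin w}
    (hp : f s p ≠ 0) : f t p ≠ 0 := by
  intro htp
  -- Away from the origin, `2 * f u p` exceeds `‖f u‖` on path `p` and is `0 < ‖f u‖` elsewhere; a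
  -- change of path would force equality somewhere.
  have hc : Continuous fun u => 2 * f u p :=
    continuous_const.mul ((PiLp.continuous_apply 1 _ p).comp hf)
  obtain ⟨u, hu, heq⟩ := hI.isPreconnected.intermediate_value₂ ht hs
    (f := fun u => 2 * f u p) (g := fun u => ‖f u‖) hc.continuousOn hf.norm.continuousOn
    (by simp [htp])
    (by
      have h1 := norm_eq_apply_of_mem_pathStar (hstar s) hp
      have h2 := (hstar s).1 p
      simp only
      linarith)
  simp only at heq
  have hpos : 0 < ‖f u‖ := norm_pos_iff.2 (h0 u hu)
  have hup : f u p ≠ 0 := by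
    intro h
    rw [h] at heq
    linarith
  rw [norm_eq_apply_of_mem_pathStar (hstar u) hup] at heq hpos
  linarith

end Star

/-! ### Excursions and their lengths -/

section Excursion

variable {E : Type*} [NormedAddCommGroup E] {f : ℝ≥0 → E} {a b s t : ℝ≥0}

theorem eVariationOn_Icc_add_Icc (f : ℝ≥0 → E) (has : a ≤ s) (hsb : s ≤ b) :
    eVariationOn f (Set.Icc a s) + eVariationOn f (Set.Icc s b) = eVariationOn f (Set.Icc a b) := by
  simpa using eVariationOn.Icc_add_Icc f has hsb (Set.mem_univ s)

/-- The largest distance from the origin in the time interval `[a, b]`. -/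
noncomputable def peak (f : ℝ≥0 → E) (a b : ℝ≥0) : ℝ :=
  sSup ((fun s => ‖f s‖) '' Set.Icc a b)

theorem exists_norm_eq_peak (hf : Continuous f) (hab : a ≤ b) :
    ∃ s ∈ Set.Icc a b, peak f a b = ‖f s‖ ∧ ∀ u ∈ Set.Icc a b, ‖f u‖ ≤ ‖f s‖ :=
  isCompact_Icc.exists_sSup_image_eq_and_ge (Set.nonempty_Icc.2 hab) hf.norm.continuousOn

theorem norm_le_peak (hf : Continuous f) (hs : s ∈ Set.Icc a b) : ‖f s‖ ≤ peak f a b := by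
  obtain ⟨u, _, hu, hmax⟩ := exists_norm_eq_peak hf (hs.1.trans hs.2)
  exact hu ▸ hmax s hs

theorem ofReal_peak_le_eVariationOn (hf : Continuous f) (hab : a ≤ b) (ha : f a = 0) :
    ENNReal.ofReal (peak f a b) ≤ eVariationOn f (Set.Icc a b) := by
  obtain ⟨s, hs, hpeak, _⟩ := exists_norm_eq_peak hf hab
  have h := eVariationOn.edist_le f (Set.left_mem_Icc.2 hab) hs
  rwa [ha, edist_dist, dist_zero_left, ← hpeak] at h

theorem two_mul_ofReal_peak_le_eVariationOn (hf : Continuous f) (hab : a ≤ b) (ha : f a = 0)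
    (hb : f b = 0) : 2 * ENNReal.ofReal (peak f a b) ≤ eVariationOn f (Set.Icc a b) := by
  obtain ⟨s, hs, hpeak, _⟩ := exists_norm_eq_peak hf hab
  have h1 := eVariationOn.edist_le f (Set.left_mem_Icc.2 hs.1) (Set.right_mem_Icc.2 hs.1)
  have h2 := eVariationOn.edist_le f (Set.left_mem_Icc.2 hs.2) (Set.right_mem_Icc.2 hs.2)
  rw [ha, edist_dist, dist_zero_left, ← hpeak] at h1
  rw [hb, edist_dist, dist_zero_right, ← hpeak] at h2
  rw [two_mul, ← eVariationOn_Icc_add_Icc f hs.1 hs.2]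
  exact add_le_add h1 h2

/-- The motion `f` leaves the origin at time `a` and is back for the first time at time `b`. -/
structure IsExcursion (f : ℝ≥0 → E) (a b : ℝ≥0) : Prop where
  lt : a < b
  left : f a = 0
  right : f b = 0
  ne_zero : ∀ s ∈ Set.Ioo a b, f s ≠ 0

/-- If they overlapped, an endpoint of one would be a zero inside the other. -/
theorem IsExcursion.right_le_left {a' b' : ℝ≥0} (h : IsExcursion f a b) (h' : IsExcursion f a' b')
    (hne : (a', b') ≠ (a, b)) (hle : b' ≤ b) : b' ≤ a := by
  by_contra! hlt
  have hb : b' = b := by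
    by_contra hb
    exact h.ne_zero b' ⟨hlt, lt_of_le_of_ne hle hb⟩ h'.right
  subst hb
  rcases lt_trichotomy a a' with hlt' | rfl | hlt'
  · exact h.ne_zero a' ⟨hlt', h'.lt⟩ h'.left
  · exact hne rfl
  · exact h'.ne_zero a ⟨hlt', h.lt⟩ h.left

/-- Induction on the excursion that ends last: the others end before it starts, so the variation
splits at its starting time. -/
theorem sum_two_mul_ofReal_peak_le {κ : Type*} (hf : Continuous f) (k : κ)
    (G : Finset (κ × ℝ≥0 × ℝ≥0))
    (hG : ∀ e ∈ G, e.1 = k ∧ IsExcursion f e.2.1 e.2.2 ∧ e.2.2 ≤ t) :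
    ∑ e ∈ G, 2 * ENNReal.ofReal (peak f e.2.1 e.2.2) ≤ eVariationOn f (Set.Icc 0 t) := by
  classical
  induction G using Finset.induction_on_max_value (fun e : κ × ℝ≥0 × ℝ≥0 => e.2.2)
    generalizing t with
  | empty => simp
  | insert e G heG hmax ih =>
    obtain ⟨hek, hex, het⟩ := hG e (Finset.mem_insert_self _ _)
    have h1 := ih (t := e.2.1) fun e' he' => by
      obtain ⟨hek', hex', -⟩ := hG e' (Finset.mem_insert_of_mem he')
      refine ⟨hek', hex', hex.right_le_left hex' (fun h => heG ?_) (hmax e' he')⟩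
      rwa [← show e' = e from Prod.ext (hek'.trans hek.symm) h]
    have h2 := two_mul_ofReal_peak_le_eVariationOn hf hex.lt.le hex.left hex.right
    rw [Finset.sum_insert heG, add_comm]
    calc _ ≤ eVariationOn f (Set.Icc 0 e.2.1) + eVariationOn f (Set.Icc e.2.1 e.2.2) :=
          add_le_add h1 h2
      _ = eVariationOn f (Set.Icc 0 e.2.2) := eVariationOn_Icc_add_Icc f zero_le hex.lt.le
      _ ≤ _ := eVariationOn.mono f (Set.Icc_subset_Icc_right het)

theorem exists_last_zero (hf : Continuous f) (h0 : f 0 = 0) (t : ℝ≥0) :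
    ∃ a ≤ t, f a = 0 ∧ ∀ s ∈ Set.Ioc a t, f s ≠ 0 := by
  have hcl : IsClosed {s | f s = 0} := isClosed_eq hf continuous_const
  obtain ⟨a, ⟨ha, ha0⟩, hmax⟩ := (isCompact_Icc.inter_right hcl).exists_isGreatest
    ⟨0, Set.left_mem_Icc.2 zero_le, h0⟩
  exact ⟨a, ha.2, ha0, fun s hs hs0 =>
    absurd (hmax ⟨⟨zero_le, hs.2⟩, hs0⟩) (not_le.2 hs.1)⟩

theorem exists_first_zero (hf : Continuous f) (hst : s ≤ t) (ht : f t = 0) :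
    ∃ b, s ≤ b ∧ b ≤ t ∧ f b = 0 ∧ ∀ u ∈ Set.Ico s b, f u ≠ 0 := by
  have hcl : IsClosed {s | f s = 0} := isClosed_eq hf continuous_const
  obtain ⟨b, ⟨hb, hb0⟩, hmin⟩ := (isCompact_Icc.inter_right hcl).exists_isLeast
    ⟨t, Set.right_mem_Icc.2 hst, ht⟩
  exact ⟨b, hb.1, hb.2, hb0, fun u hu hu0 =>
    absurd (hmin ⟨⟨hu.1, hu.2.le.trans hb.2⟩, hu0⟩) (not_le.2 hu.2)⟩

end Excursion

/-! ### The lower bound -/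

namespace ExplorationAlgorithm

variable {w l : ℕ} (A : ExplorationAlgorithm w l)

theorem travelled_mono : Monotone A.travelled := fun _ _ h =>
  Finset.sum_le_sum fun _ _ => eVariationOn.mono _ (Set.Iic_subset_Iic.2 h)

/-- The last time up to `t` at which robot `k` is at the origin. -/
noncomputable def lastZero (k : Fin l) (t : ℝ≥0) : ℝ≥0 :=
  (exists_last_zero (A.continuous_position k) (A.position_zero k) t).choose

theorem lastZero_spec (k : Fin l) (t : ℝ≥0) : A.lastZero k t ≤ t ∧
    A.position k (A.lastZero k t) = 0 ∧
      ∀ s ∈ Set.Ioc (A.lastZero k t) t, A.position k s ≠ 0 :=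
  (exists_last_zero (A.continuous_position k) (A.position_zero k) t).choose_spec

/-- The height reached by robot `k` in the excursion that it is on at time `t`. -/
noncomputable def currentPeak (k : Fin l) (t : ℝ≥0) : ℝ :=
  peak (A.position k) (A.lastZero k t) t

/-- The height of the excursion `e = (k, a, b)` of robot `k`. -/
noncomputable def height (e : Fin l × ℝ≥0 × ℝ≥0) : ℝ :=
  peak (A.position e.1) e.2.1 e.2.2

/-- The excursions of height at least `1` finished by time `t`. -/
def finished (t : ℝ≥0) : Set (Fin l × ℝ≥0 × ℝ≥0) :=
  {e | IsExcursion (A.position e.1) e.2.1 e.2.2 ∧ e.2.2 ≤ t ∧ 1 ≤ A.height e}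

theorem finished_mono {s t : ℝ≥0} (h : s ≤ t) : A.finished s ⊆ A.finished t :=
  fun _ he => ⟨he.1, he.2.1.trans h, he.2.2⟩

/-- Each trajectory is cut at the robot's last zero: finished excursions lie before it, and what
follows costs at least the current peak, counted once since there is no return yet. -/
theorem two_mul_sum_height_add_le_travelled {t : ℝ≥0} {G : Finset (Fin l × ℝ≥0 × ℝ≥0)}
    (hG : ∀ e ∈ G, e ∈ A.finished t) :
    ∑ e ∈ G, 2 * ENNReal.ofReal (A.height e) + ∑ k, ENNReal.ofReal (A.currentPeak k t) ≤
      A.travelled t := by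
  rw [← Finset.sum_fiberwise G Prod.fst, ← Finset.sum_add_distrib]
  refine Finset.sum_le_sum fun k _ => ?_
  obtain ⟨hle, h0, hne⟩ := A.lastZero_spec k t
  have h1 := sum_two_mul_ofReal_peak_le (t := A.lastZero k t) (A.continuous_position k) k
    (G.filter fun e => e.1 = k) fun e he => by
      obtain ⟨heG, hek⟩ := Finset.mem_filter.1 he
      obtain ⟨hex, het, -⟩ := hG e heG
      subst hek
      refine ⟨rfl, hex, ?_⟩
      by_contra! hlt
      exact hne _ ⟨hlt, het⟩ hex.right
  have h2 := ofReal_peak_le_eVariationOn (A.continuous_position k) hle h0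
  have h3 := eVariationOn_Icc_add_Icc (A.position k) zero_le hle
  have h4 : ∑ e ∈ G with e.1 = k, 2 * ENNReal.ofReal (A.height e) =
      ∑ e ∈ G with e.1 = k, 2 * ENNReal.ofReal (peak (A.position k) e.2.1 e.2.2) :=
    Finset.sum_congr rfl fun e he => by rw [height, (Finset.mem_filter.1 he).2]
  have h5 : Set.Iic t = Set.Icc 0 t := Set.Icc_bot.symm
  rw [h4, h5, ← h3]
  exact add_le_add h1 h2

/-- The height threshold `1` makes each excursion cost at least a fixed amount; it loses nothing for
levels `v ≥ 1`. -/
theorem finite_finished {t : ℝ≥0} (ht : A.travelled t ≠ ⊤) : (A.finished t).Finite := by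
  by_contra hinf
  obtain ⟨n, hn⟩ := ENNReal.exists_nat_gt ht
  obtain ⟨G, hG, hcard⟩ := Set.Infinite.exists_subset_card_eq hinf n
  have h1 := A.two_mul_sum_height_add_le_travelled (G := G) (t := t) fun e he => hG he
  have h2 : (n : ℝ≥0∞) ≤ ∑ e ∈ G, 2 * ENNReal.ofReal (A.height e) := by
    rw [← hcard, ← nsmul_one]
    refine Finset.card_nsmul_le_sum _ _ _ fun e he => ?_
    have h3 : (1 : ℝ≥0∞) ≤ ENNReal.ofReal (A.height e) := by
      rw [ENNReal.one_le_ofReal]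
      exact (hG he).2.2
    calc (1 : ℝ≥0∞) ≤ 2 * 1 := by norm_num
      _ ≤ _ := by gcongr
  exact absurd (h2.trans (le_self_add.trans h1)) (not_le.2 hn)

/-- If all paths have been explored up to `v`, the excursions that did this are different. -/
theorem le_card_finished_add_card_current {t : ℝ≥0} {v : ℝ} (hv : 1 ≤ v)
    {F : Finset (Fin l × ℝ≥0 × ℝ≥0)} (hF : ∀ e, e ∈ F ↔ e ∈ A.finished t)
    (h : ∀ p, ∃ s ≤ t, A.Reaches p v s) :
    w ≤ (F.filter fun e => v ≤ A.height e).card +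
      (Finset.univ.filter fun k => v ≤ A.currentPeak k t).card := by
  classical
  have hv0 : v ≠ 0 := by positivity
  -- Each path gets a finished (`inl`) or current (`inr`) excursion that visits it. The recorded
  -- visit gives injectivity, as an excursion meets only one path.
  have key : ∀ p, ∃ x ∈ (F.filter fun e => v ≤ A.height e).disjSum
      (Finset.univ.filter fun k => v ≤ A.currentPeak k t),
      (∀ e, x = Sum.inl e → ∃ s ∈ Set.Ioo e.2.1 e.2.2, A.position e.1 s p ≠ 0) ∧
      ∀ k, x = Sum.inr k → ∃ s ∈ Set.Ioc (A.lastZero k t) t, A.position k s p ≠ 0 := by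
    intro p
    obtain ⟨s, hst, k, hk⟩ := h p
    have hsp : A.position k s p ≠ 0 := hk ▸ hv0
    have hs0 : A.position k s ≠ 0 := fun h => hsp (by simp [h])
    have hnorm : v ≤ ‖A.position k s‖ :=
      (norm_eq_apply_of_mem_pathStar (A.position_mem_star k s) hsp).trans hk |>.ge
    obtain ⟨hle, h0, hne⟩ := A.lastZero_spec k t
    rcases lt_or_ge (A.lastZero k t) s with hlt | hge
    · refine ⟨Sum.inr k, ?_, by simp, ?_⟩
      · simp only [Finset.inr_mem_disjSum, Finset.mem_filter, Finset.mem_univ, true_and]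
        exact hnorm.trans (norm_le_peak (A.continuous_position k) ⟨hlt.le, hst⟩)
      · rintro _ ⟨⟩
        exact ⟨s, ⟨hlt, hst⟩, hsp⟩
    · obtain ⟨a, has, ha0, ha⟩ := exists_last_zero (A.continuous_position k) (A.position_zero k) s
      obtain ⟨b, hsb, hbt, hb0, hb⟩ := exists_first_zero (A.continuous_position k) hge h0
      have has' : a < s := lt_of_le_of_ne has fun h => hs0 (h ▸ ha0)
      have hsb' : s < b := lt_of_le_of_ne hsb fun h => hs0 (h ▸ hb0)
      have hheight : v ≤ A.height (k, a, b) :=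
        hnorm.trans (norm_le_peak (A.continuous_position k) ⟨has, hsb⟩)
      refine ⟨Sum.inl (k, a, b), ?_, ?_, by simp⟩
      · simp only [Finset.inl_mem_disjSum, Finset.mem_filter]
        refine ⟨(hF _).2 ⟨⟨has'.trans hsb', ha0, hb0, fun u hu => ?_⟩, hbt.trans hle,
          hv.trans hheight⟩, hheight⟩
        rcases le_total u s with hus | hsu
        · exact ha u ⟨hu.1, hus⟩
        · exact hb u ⟨hsu, hu.2⟩
      · rintro _ ⟨⟩
        exact ⟨s, ⟨has', hsb'⟩, hsp⟩
  choose x hx hinl hinr using key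
  have hinj : Function.Injective x := by
    intro p q hpq
    have hsame : ∀ (k : Fin l) (I : Set ℝ≥0), I.OrdConnected →
        (∀ u ∈ I, A.position k u ≠ 0) → (∃ s ∈ I, A.position k s p ≠ 0) →
        (∃ s ∈ I, A.position k s q ≠ 0) → p = q := by
      rintro k I hI h0 ⟨s, hs, hsp⟩ ⟨s', hs', hsq⟩
      exact (A.position_mem_star k s').2 p q (apply_ne_zero_of_forall_ne_zero
        (A.continuous_position k) (A.position_mem_star k) hI h0 hs hs' hsp) hsq
    rcases hxp : x p with e | k
    · have he : e ∈ F := by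
        have := hx p
        rw [hxp, Finset.inl_mem_disjSum] at this
        exact (Finset.mem_filter.1 this).1
      exact hsame e.1 _ Set.ordConnected_Ioo ((hF e).1 he).1.ne_zero (hinl p e hxp)
        (hinl q e (hpq ▸ hxp))
    · exact hsame k _ Set.ordConnected_Ioc (A.lastZero_spec k t).2.2 (hinr p k hxp)
        (hinr q k (hpq ▸ hxp))
  have := Finset.card_le_card_of_injOn (s := Finset.univ) x (fun p _ => hx p) hinj.injOn
  simpa using this

/-- The first time at which some robot stands on path `p` at distance `v`. -/
noncomputable def reachTime (p : Fin w) (v : ℝ) : ℝ≥0 := sInf {t | A.Reaches p v t}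

/-- The first time at which all the paths have been explored up to distance `v`. -/
noncomputable def exploreTime (v : ℝ) : ℝ≥0 := Finset.univ.sup fun p => A.reachTime p v

theorem exists_reaches_of_goalCost_ne_top {p : Fin w} {v : ℝ} (h : A.goalCost p v ≠ ⊤) :
    ∃ t, A.Reaches p v t := by
  by_contra! hno
  exact h (by simp [goalCost, hno])

theorem reaches_reachTime {p : Fin w} {v : ℝ} (h : ∃ t, A.Reaches p v t) :
    A.Reaches p v (A.reachTime p v) := by
  have hcl : IsClosed {t | A.Reaches p v t} := by
    simp only [Reaches, Set.ofPred_exists]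
    exact isClosed_iUnion_of_finite fun k => isClosed_eq
      ((PiLp.continuous_apply 1 _ p).comp (A.continuous_position k)) continuous_const
  exact hcl.csInf_mem h (OrderBot.bddBelow _)

theorem reachTime_mono {p : Fin w} {v v' : ℝ} (hv : 0 ≤ v) (hvv' : v ≤ v')
    (h : ∃ t, A.Reaches p v' t) : A.reachTime p v ≤ A.reachTime p v' := by
  obtain ⟨k, hk⟩ := A.reaches_reachTime h
  have hc : Continuous fun s => A.position k s p :=
    (PiLp.continuous_apply 1 _ p).comp (A.continuous_position k)
  have h0 : A.position k 0 p = 0 := by simp [A.position_zero]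
  obtain ⟨s, hs, hsv⟩ := intermediate_value_Icc zero_le hc.continuousOn
    ⟨h0.trans_le hv, hvv'.trans hk.ge⟩
  have hmem : s ∈ {t | A.Reaches p v t} := ⟨k, hsv⟩
  exact (csInf_le (OrderBot.bddBelow _) hmem).trans hs.2

/-- The exploration time is the reach time of some worst path. If that path is never reached at `v`,
the cost is `∞` and the default value of `sInf` does no harm. -/
theorem travelled_exploreTime_le_cost (v : ℝ) : A.travelled (A.exploreTime v) ≤ A.cost v := by
  rcases Nat.eq_zero_or_pos w with rfl | hw
  · have : A.exploreTime v = 0 := by simp [exploreTime]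
    rw [this, travelled]
    refine (Finset.sum_eq_zero fun k _ => ?_).trans_le zero_le
    exact eVariationOn.subsingleton _ fun x hx y hy => by simp_all
  · have : Nonempty (Fin w) := ⟨⟨0, hw⟩⟩
    obtain ⟨p, -, hp⟩ := Finset.exists_mem_eq_sup Finset.univ Finset.univ_nonempty
      fun p => A.reachTime p v
    rw [exploreTime, hp]
    refine le_trans ?_ (le_iSup _ p)
    exact le_iInf₂ fun t ht => A.travelled_mono (csInf_le (OrderBot.bddBelow _) ht)

variable {A} in
theorem HasCompetitiveRatio.exists_forall_cost_le {c ε : ℝ} (h : A.HasCompetitiveRatio c)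
    (hε : 0 < ε) : ∃ v₀, 1 ≤ v₀ ∧ ∀ v, v₀ ≤ v → A.cost v ≤ ENNReal.ofReal ((c + ε) * v) := by
  obtain ⟨g, hg, hcost⟩ := h
  obtain ⟨v₁, hv₁⟩ := Filter.eventually_atTop.1 (hg.def hε)
  refine ⟨max 1 v₁, le_max_left _ _, fun v hv => ?_⟩
  have hv1 : 1 ≤ v := (le_max_left _ _).trans hv
  refine (hcost v (by linarith)).trans (ENNReal.ofReal_le_ofReal ?_)
  have h1 := hv₁ v ((le_max_right _ _).trans hv)
  rw [Real.norm_of_nonneg (by linarith : (0 : ℝ) ≤ v)] at h1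
  linarith [Real.le_norm_self (g v)]

/-- What a cost of at most `c * v` means for the excursions made until all paths have been explored
up to `v`; here `D` counts the robots that are not beyond `v` in their current excursion. -/
theorem exists_card_add_le_and_sum_le (hw : l ≤ w) (hw1 : 1 ≤ w) {c v : ℝ} (hv : 1 ≤ v)
    (hcost : A.cost v ≤ ENNReal.ofReal (c * v)) {F : Finset (Fin l × ℝ≥0 × ℝ≥0)}
    (hF : ∀ e, e ∈ F ↔ e ∈ A.finished (A.exploreTime v)) :
    ∃ D : ℕ, w - l + D ≤ (F.filter fun e => v ≤ A.height e).card ∧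
      2 * ∑ e ∈ F, A.height e ≤ (c - l + D) * v := by
  set t := A.exploreTime v
  set K := Finset.univ.filter fun k => v ≤ A.currentPeak k t with hK
  have hKl : K.card ≤ l := by simpa using Finset.card_le_univ K
  have hreach : ∀ p, ∃ s ≤ t, A.Reaches p v s := fun p => by
    refine ⟨A.reachTime p v, Finset.le_sup (f := fun p => A.reachTime p v) (Finset.mem_univ p),
      A.reaches_reachTime (A.exists_reaches_of_goalCost_ne_top ?_)⟩
    exact ne_top_of_le_ne_top ENNReal.ofReal_ne_top ((le_iSup _ p).trans hcost)
  have hcard := A.le_card_finished_add_card_current hv hF hreach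
  rw [← hK] at hcard
  refine ⟨l - K.card, by omega, ?_⟩
  have hpos : ∀ e ∈ F, 1 ≤ A.height e := fun e he => ((hF e).1 he).2.2
  have hsum0 : 0 ≤ ∑ e ∈ F, A.height e :=
    Finset.sum_nonneg fun e he => zero_le_one.trans (hpos e he)
  have h1 := (A.two_mul_sum_height_add_le_travelled fun e he => (hF e).1 he).trans
    ((A.travelled_exploreTime_le_cost v).trans hcost)
  have h2 : ENNReal.ofReal (2 * ∑ e ∈ F, A.height e + K.card * v) ≤
      ENNReal.ofReal (c * v) := by
    refine le_trans ?_ h1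
    rw [ENNReal.ofReal_add (by positivity) (by positivity)]
    refine add_le_add (le_of_eq ?_) ?_
    · rw [ENNReal.ofReal_mul zero_le_two, ENNReal.ofReal_sum_of_nonneg
        fun e he => zero_le_one.trans (hpos e he), Finset.mul_sum]
      simp
    · calc ENNReal.ofReal (K.card * v) = K.card • ENNReal.ofReal v := by
            rw [ENNReal.ofReal_mul (by positivity), ENNReal.ofReal_natCast, nsmul_eq_mul]
        _ ≤ ∑ k ∈ K, ENNReal.ofReal (A.currentPeak k t) :=
            Finset.card_nsmul_le_sum _ _ _ fun k hk =>
              ENNReal.ofReal_le_ofReal (Finset.mem_filter.1 hk).2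
        _ ≤ _ := Finset.sum_le_sum_of_subset (Finset.subset_univ _)
  have h3 : 2 * ∑ e ∈ F, A.height e + K.card * v ≤ c * v := by
    rcases ENNReal.ofReal_le_ofReal_iff'.1 h2 with h3 | h3
    · exact h3
    -- Here `c * v ≤ 0` and the truncation of `ENNReal.ofReal` could hide the inequality; but the
    -- left side is positive, since `w ≥ 1` paths need a high excursion.
    · exfalso
      have hK0 : 0 ≤ (K.card : ℝ) * v := by positivity
      have hK1 : (K.card : ℝ) * v = 0 := by linarith
      have hKc : K.card = 0 := by
        rcases mul_eq_zero.1 hK1 with h | h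
        · exact_mod_cast h
        · linarith
      obtain ⟨e, he⟩ : (F.filter fun e => v ≤ A.height e).Nonempty := by
        rw [← Finset.card_pos]
        omega
      have heF := (Finset.mem_filter.1 he).1
      have := Finset.single_le_sum (f := A.height)
        (fun e he => zero_le_one.trans (hpos e he)) heF
      linarith [hpos e heF]
  rw [Nat.cast_sub hKl]
  linarith

variable {A}

theorem HasCompetitiveRatio.le_of_lt {c : ℝ} (hA : A.HasCompetitiveRatio c) (hlw : l < w) :
    (l : ℝ) + 2 * (((w : ℝ) - l + 1) ^ (w - l + 1) / ((w : ℝ) - l) ^ (w - l)) ≤ c := by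
  refine le_of_forall_pos_le_add fun ε hε => ?_
  obtain ⟨v₀, hv₀, hcost⟩ := hA.exists_forall_cost_le hε
  -- The `max` only serves to define a finite set for every real `v`.
  have hfin : ∀ v, (A.finished (A.exploreTime (max v v₀))).Finite := fun v =>
    A.finite_finished (ne_top_of_le_ne_top ENNReal.ofReal_ne_top
      ((A.travelled_exploreTime_le_cost _).trans (hcost _ (le_max_right _ _))))
  have hex : ∀ v, ∃ D : ℕ, v₀ ≤ v →
      w - l + D ≤ ((hfin v).toFinset.filter fun e => v ≤ A.height e).card ∧
      2 * ∑ e ∈ (hfin v).toFinset, A.height e ≤ (c + ε - l + D) * v := by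
    intro v
    by_cases hv : v₀ ≤ v
    · obtain ⟨D, hD⟩ := A.exists_card_add_le_and_sum_le hlw.le (by omega) (hv₀.trans hv)
        (hcost v hv) (F := (hfin v).toFinset) fun e => by
          rw [Set.Finite.mem_toFinset, max_eq_left hv]
      exact ⟨D, fun _ => hD⟩
    · exact ⟨0, fun h => absurd h hv⟩
  choose D hD using hex
  have hmain := pow_div_pow_le_of_excursions (x := A.height) (m := w - l) (by omega)
    (C := (c + ε - l) / 2) (v₀ := v₀) (F := fun v => (hfin v).toFinset) (D := D)
    (fun v v' hv hvv' => by
      rw [Set.Finite.toFinset_subset_toFinset, max_eq_left hv, max_eq_left (hv.trans hvv')]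
      refine A.finished_mono (Finset.sup_mono_fun fun p _ =>
        A.reachTime_mono (by linarith) hvv' (A.exists_reaches_of_goalCost_ne_top ?_))
      exact ne_top_of_le_ne_top ENNReal.ofReal_ne_top
        ((le_iSup _ p).trans (hcost v' (hv.trans hvv'))))
    (fun v e he => by
      have := ((Set.Finite.mem_toFinset _).1 he).2.2
      linarith)
    (fun v hv => (hD v hv).1)
    (fun v hv => by
      have := (hD v hv).2
      linarith)
  rw [Nat.cast_sub hlw.le] at hmain
  linarith

/-- With `w = l` the `D` high finished excursions give `2 * D * v ≤ (c + ε - w + D) * v`, so already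
one level `v` suffices. -/
theorem HasCompetitiveRatio.le_of_eq {c : ℝ} {w : ℕ} {A : ExplorationAlgorithm w w}
    (hA : A.HasCompetitiveRatio c) (hw : 1 ≤ w) : (w : ℝ) ≤ c := by
  refine le_of_forall_pos_le_add fun ε hε => ?_
  obtain ⟨v, hv, hcost⟩ := hA.exists_forall_cost_le hε
  have hcv := hcost v le_rfl
  have hfin : (A.finished (A.exploreTime v)).Finite :=
    A.finite_finished (ne_top_of_le_ne_top ENNReal.ofReal_ne_top
      ((A.travelled_exploreTime_le_cost _).trans hcv))
  obtain ⟨D, hD, hsum⟩ := A.exists_card_add_le_and_sum_le le_rfl hw hv hcv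
    (F := hfin.toFinset) fun e => hfin.mem_toFinset
  have h1 : D • v ≤ ∑ e ∈ hfin.toFinset, A.height e := by
    calc D • v ≤ (hfin.toFinset.filter fun e => v ≤ A.height e).card • v := by
          gcongr
          omega
      _ ≤ ∑ e ∈ hfin.toFinset with v ≤ A.height e, A.height e :=
          Finset.card_nsmul_le_sum _ _ _ fun e he => (Finset.mem_filter.1 he).2
      _ ≤ _ := Finset.sum_le_sum_of_subset_of_nonneg (Finset.filter_subset _ _)
          fun e he _ => zero_le_one.trans (hfin.mem_toFinset.1 he).2.2
  rw [nsmul_eq_mul] at h1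
  have h2 : 0 ≤ (D : ℝ) * v := by positivity
  nlinarith

end ExplorationAlgorithm

/-! ### Motions glued from unit time intervals -/

section Gluing

variable {X : Type*} {F : ℕ → ℝ≥0 → X}

theorem eqOn_floor_glue (hglue : ∀ i : ℕ, F i (i + 1) = F (i + 1) (i + 1)) (i : ℕ) :
    Set.EqOn (fun t => F ⌊t⌋₊ t) (F i) (Set.Icc (i : ℝ≥0) (i + 1)) := by
  intro t ht
  rcases ht.2.lt_or_eq with hlt | rfl
  · simp only [(Nat.floor_eq_iff (zero_le (a := t))).2 ⟨ht.1, hlt⟩]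
  · have : ⌊(i : ℝ≥0) + 1⌋₊ = i + 1 := by exact_mod_cast Nat.floor_natCast (R := ℝ≥0) (i + 1)
    simp only [this, hglue]

theorem continuous_floor_glue [TopologicalSpace X] (hF : ∀ i, Continuous (F i))
    (hglue : ∀ i : ℕ, F i (i + 1) = F (i + 1) (i + 1)) :
    Continuous fun t : ℝ≥0 => F ⌊t⌋₊ t := by
  have hn : ∀ n : ℕ, ContinuousOn (fun t => F ⌊t⌋₊ t) (Set.Iic (n : ℝ≥0)) := by
    intro n
    induction n with
    | zero =>
      have : Set.Iic ((0 : ℕ) : ℝ≥0) = {0} := by ext; simp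
      rw [this]
      exact continuousOn_singleton _ _
    | succ n ih =>
      have hu : Set.Iic ((n + 1 : ℕ) : ℝ≥0) = Set.Iic (n : ℝ≥0) ∪ Set.Icc (n : ℝ≥0) (n + 1) := by
        rw [Set.Iic_union_Icc_eq_Iic (by simp)]
        push_cast
        rfl
      rw [hu]
      exact ih.union_of_isClosed ((hF n).continuousOn.congr (eqOn_floor_glue hglue n))
        isClosed_Iic isClosed_Icc
  refine continuous_iff_continuousAt.2 fun t => (hn (⌊t⌋₊ + 1)).continuousAt ?_
  exact Iic_mem_nhds (by exact_mod_cast Nat.lt_floor_add_one t)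

end Gluing

section Single

variable {w : ℕ}

theorem single_mem_pathStar (p : Fin w) {a : ℝ} (ha : 0 ≤ a) : PiLp.single 1 p a ∈ pathStar w := by
  refine ⟨fun q => ?_, fun q q' hq hq' => ?_⟩
  · rw [PiLp.single_apply]
    split_ifs <;> simp [ha]
  · simp only [PiLp.single_apply, ne_eq, ite_eq_right_iff, Classical.not_imp] at hq hq'
    rw [hq.1, hq'.1]

theorem lipschitzWith_single (p : Fin w) :
    LipschitzWith 1 fun a : ℝ => (PiLp.single 1 p a : PiLp 1 fun _ : Fin w => ℝ) :=
  LipschitzWith.of_dist_le_mul fun a b => by simp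

theorem eVariationOn_single_le {h : ℝ≥0 → ℝ} (hh : Monotone h) (h0 : h 0 = 0) (p : Fin w)
    (t : ℝ≥0) : eVariationOn (fun s => (PiLp.single 1 p (h s) : PiLp 1 fun _ : Fin w => ℝ))
      (Set.Iic t) ≤ ENNReal.ofReal (h t) := by
  have h1 := (lipschitzWith_single p).lipschitzOnWith.comp_eVariationOn_le
    (Set.mapsTo_univ h (Set.Iic t))
  have h2 := (hh.monotoneOn Set.univ).eVariationOn_eq (Set.mem_univ 0) (Set.mem_univ t)
  rw [Set.univ_inter, h0, sub_zero, show Set.Icc 0 t = Set.Iic t from Set.Icc_bot] at h2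
  rw [h2, ENNReal.coe_one, one_mul] at h1
  exact h1

end Single

/-! ### The zigzag and sweep motions -/

section Zigzag

/-- The distance from the origin, at time `t`, in an excursion of height `r ^ (i + q)` in the time
interval `[i, i + 1]`. -/
noncomputable def tent (r : ℝ) (q i : ℕ) (t : ℝ) : ℝ :=
  r ^ (i + q) * max 0 (min (2 * (t - i)) (2 - 2 * (t - i)))

/-- A motion from `r ^ i - 1` to `r ^ (i + 1) - 1` in the time interval `[i, i + 1]`, which keeps
pace with the ascent of `tent r q i`. -/
noncomputable def ramp (r : ℝ) (q i : ℕ) (t : ℝ) : ℝ :=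
  max (r ^ i) (min (r ^ (i + 1)) (2 * r ^ (i + q) * (t - i))) - 1

/-- The robot that searches, in phase `i`, the path `path i` up to the distance `r ^ (i + q)`. -/
noncomputable def zigzag {w : ℕ} (r : ℝ) (q : ℕ) (path : ℕ → Fin w) (t : ℝ≥0) :
    PiLp 1 fun _ : Fin w => ℝ :=
  PiLp.single 1 (path ⌊t⌋₊) (tent r q ⌊t⌋₊ t)

/-- The distance from the origin of the robots that stay on one path. -/
noncomputable def sweep (r : ℝ) (q : ℕ) (t : ℝ≥0) : ℝ := ramp r q ⌊t⌋₊ t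

variable {r : ℝ} {q : ℕ}

theorem tent_nonneg (hr : 1 < r) (i : ℕ) (t : ℝ) : 0 ≤ tent r q i t :=
  mul_nonneg (by positivity) (le_max_left _ _)

theorem tent_left (i : ℕ) : tent r q i i = 0 := by simp [tent]

theorem tent_right (i : ℕ) : tent r q i (i + 1) = 0 := by simp [tent]

theorem ramp_left (hr : 1 < r) (i : ℕ) : ramp r q i i = r ^ i - 1 := by
  have h1 : 0 ≤ r ^ (i + 1) := by positivity
  have h2 : 0 ≤ r ^ i := by positivity
  simp [ramp, h1, h2]

theorem ramp_right (hr : 1 < r) (hq : 1 ≤ q) (i : ℕ) : ramp r q i (i + 1) = r ^ (i + 1) - 1 := by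
  have h1 : r ^ (i + 1) ≤ r ^ (i + q) := pow_le_pow_right₀ hr.le (by omega)
  have h2 : r ^ i ≤ r ^ (i + 1) := pow_le_pow_right₀ hr.le (by omega)
  have h3 : 0 ≤ r ^ (i + 1) := by positivity
  rw [ramp, add_sub_cancel_left, min_eq_left (by linarith), max_eq_right h2]

theorem monotone_ramp (hr : 1 < r) (i : ℕ) : Monotone (ramp r q i) := by
  intro s t hst
  have : 0 ≤ r ^ (i + q) := by positivity
  unfold ramp
  gcongr

theorem continuous_sweep (hr : 1 < r) (hq : 1 ≤ q) : Continuous (sweep r q) := by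
  refine continuous_floor_glue (F := fun i t => ramp r q i t) (fun i => ?_) fun i => ?_
  · unfold ramp
    fun_prop
  · have := ramp_left (q := q) hr (i + 1)
    push_cast at this ⊢
    rw [ramp_right hr hq, this]

theorem sweep_zero (hr : 1 < r) : sweep r q 0 = 0 := by
  have := ramp_left (q := q) hr 0
  simpa [sweep] using this

theorem monotone_sweep (hr : 1 < r) : Monotone (sweep r q) := by
  intro s t hst
  rcases (Nat.floor_mono hst).lt_or_eq with hlt | heq
  · have h1 : r ^ (⌊s⌋₊ + 1) ≤ r ^ ⌊t⌋₊ := pow_le_pow_right₀ hr.le hlt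
    have h2 : r ^ ⌊s⌋₊ ≤ r ^ (⌊s⌋₊ + 1) := pow_le_pow_right₀ hr.le (by omega)
    have h3 : sweep r q s ≤ r ^ (⌊s⌋₊ + 1) - 1 :=
      sub_le_sub_right (max_le h2 (min_le_left _ _)) _
    have h4 : r ^ ⌊t⌋₊ - 1 ≤ sweep r q t := sub_le_sub_right (le_max_left _ _) _
    linarith
  · rw [sweep, sweep, heq]
    exact monotone_ramp hr _ (NNReal.coe_le_coe.2 hst)

theorem sweep_nonneg (hr : 1 < r) (t : ℝ≥0) : 0 ≤ sweep r q t :=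
  (sweep_zero hr).ge.trans (monotone_sweep hr zero_le)

variable {w : ℕ} {path : ℕ → Fin w}

theorem zigzag_glue (i : ℕ) :
    (PiLp.single 1 (path i) (tent r q i ((i + 1 : ℝ≥0) : ℝ)) : PiLp 1 fun _ : Fin w => ℝ) =
      PiLp.single 1 (path (i + 1)) (tent r q (i + 1) ((i + 1 : ℝ≥0) : ℝ)) := by
  have h := tent_left (r := r) (q := q) (i + 1)
  push_cast at h ⊢
  rw [tent_right, h, (PiLp.single_eq_zero_iff 1 _).2 rfl, (PiLp.single_eq_zero_iff 1 _).2 rfl]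

theorem continuous_zigzag : Continuous (zigzag r q path) := by
  refine continuous_floor_glue
    (F := fun i t => (PiLp.single 1 (path i) (tent r q i t) : PiLp 1 fun _ : Fin w => ℝ))
    (fun i => ?_) zigzag_glue
  refine (lipschitzWith_single (path i)).continuous.comp ?_
  unfold tent
  fun_prop

theorem zigzag_zero : zigzag r q path 0 = 0 := by
  have := tent_left (r := r) (q := q) 0
  simp only [Nat.cast_zero] at this
  simp [zigzag, this]

theorem lipschitzWith_tent (hr : 1 < r) (i : ℕ) :
    LipschitzWith (2 * r ^ (i + q)).toNNReal (tent r q i) := by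
  refine LipschitzWith.of_dist_le_mul fun s t => ?_
  have hpos : 0 ≤ r ^ (i + q) := by positivity
  rw [Real.coe_toNNReal _ (by positivity), Real.dist_eq, Real.dist_eq, tent, tent, ← mul_sub,
    abs_mul, abs_of_nonneg hpos, mul_comm 2 (r ^ (i + q)), mul_assoc]
  refine mul_le_mul_of_nonneg_left ?_ hpos
  refine (abs_max_sub_max_le_max _ _ _ _).trans (max_le (by simp) ?_)
  refine (abs_min_sub_min_le_max _ _ _ _).trans (max_le ?_ ?_)
  · rw [show 2 * (s - i) - 2 * (t - i) = 2 * (s - t) by ring, abs_mul, abs_two]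
  · rw [show 2 - 2 * (s - i) - (2 - 2 * (t - i)) = 2 * (t - s) by ring, abs_mul, abs_two,
      abs_sub_comm]

theorem eVariationOn_zigzag_Icc_le (hr : 1 < r) (i : ℕ) {t : ℝ≥0}
    (hti : t ≤ i + 1) : eVariationOn (zigzag r q path) (Set.Icc (i : ℝ≥0) t) ≤
      ENNReal.ofReal (2 * r ^ (i + q) * (t - i)) := by
  have heq : Set.EqOn (zigzag r q path) (((fun a => PiLp.single 1 (path i) a) ∘ tent r q i) ∘
      fun s : ℝ≥0 => (s : ℝ)) (Set.Icc (i : ℝ≥0) t) :=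
    (eqOn_floor_glue (F := fun i t => (PiLp.single 1 (path i) (tent r q i t) :
      PiLp 1 fun _ : Fin w => ℝ)) zigzag_glue i).mono (Set.Icc_subset_Icc_right hti)
  rw [eVariationOn.congr heq]
  refine (((lipschitzWith_single (path i)).comp
    (lipschitzWith_tent (q := q) hr i)).lipschitzOnWith.comp_eVariationOn_le
      (Set.mapsTo_univ _ _)).trans (le_of_eq ?_)
  have h2 := ((NNReal.coe_mono).monotoneOn Set.univ).eVariationOn_eq
    (Set.mem_univ (i : ℝ≥0)) (Set.mem_univ t)
  rw [Set.univ_inter] at h2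
  rw [h2, one_mul, NNReal.coe_natCast, ENNReal.ofReal_mul (by positivity)]
  rfl

/-- Phase `j` costs `2 * r ^ (j + q)`; this is the geometric sum over `j < i`. -/
theorem eVariationOn_zigzag_Iic_natCast_le (hr : 1 < r) (i : ℕ) :
    eVariationOn (zigzag r q path) (Set.Icc 0 (i : ℝ≥0)) ≤
      ENNReal.ofReal (2 * (r ^ q / (r - 1)) * (r ^ i - 1)) := by
  have hr1 : 0 < r - 1 := by linarith
  induction i with
  | zero => simp
  | succ i ih =>
    have h1 := eVariationOn_zigzag_Icc_le (q := q) (path := path) hr i (t := i + 1) le_rfl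
    push_cast at h1 ⊢
    rw [← eVariationOn_Icc_add_Icc _ (zero_le (a := (i : ℝ≥0))) (by simp)]
    refine (add_le_add ih h1).trans ?_
    have h2 : 1 ≤ r ^ i := one_le_pow₀ hr.le
    have h3 : 0 ≤ r ^ i - 1 := by linarith
    rw [← ENNReal.ofReal_add (by positivity) (by rw [add_sub_cancel_left]; positivity)]
    refine ENNReal.ofReal_le_ofReal (le_of_eq ?_)
    field_simp
    ring

theorem eVariationOn_zigzag_le (hr : 1 < r) (i : ℕ) {t : ℝ≥0} (hit : (i : ℝ≥0) ≤ t)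
    (hti : t ≤ i + 1) : eVariationOn (zigzag r q path) (Set.Iic t) ≤
      ENNReal.ofReal (2 * (r ^ q / (r - 1)) * r ^ i + 2 * r ^ (i + q) * (t - i)) := by
  have hr1 : 0 < r - 1 := by linarith
  have hit' : (0 : ℝ) ≤ t - i := by
    have : (i : ℝ) ≤ t := by exact_mod_cast hit
    linarith
  rw [show Set.Iic t = Set.Icc 0 t from Set.Icc_bot.symm,
    ← eVariationOn_Icc_add_Icc _ zero_le hit, ENNReal.ofReal_add (by positivity) (by positivity)]
  refine add_le_add ((eVariationOn_zigzag_Iic_natCast_le hr i).trans ?_)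
    (eVariationOn_zigzag_Icc_le hr i hti)
  have : 0 ≤ 2 * (r ^ q / (r - 1)) := by positivity
  exact ENNReal.ofReal_le_ofReal (mul_le_mul_of_nonneg_left (by linarith) this)

end Zigzag

/-! ### The optimal algorithms -/

/-- One robot searches the first `q` paths in turn, up to geometrically growing distances. Each of
the other robots walks on a path of its own, as far as the first robot has explored its paths. -/
noncomputable def zigzagAlgorithm (q l : ℕ) (hq : 1 ≤ q) {r : ℝ} (hr : 1 < r) :
    ExplorationAlgorithm (q + l) (l + 1) where
  position := Fin.cons (zigzag r q fun i => Fin.castAdd l ⟨i % q, Nat.mod_lt i hq⟩)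
    fun k t => PiLp.single 1 (Fin.natAdd q k) (sweep r q t)
  position_mem_star k t := by
    refine Fin.cases ?_ (fun k => ?_) k
    · exact single_mem_pathStar _ (tent_nonneg hr _ _)
    · exact single_mem_pathStar _ (sweep_nonneg hr t)
  position_zero k := by
    refine Fin.cases ?_ (fun k => ?_) k
    · rw [Fin.cons_zero]
      exact zigzag_zero
    · simp [sweep_zero hr]
  continuous_position k := by
    refine Fin.cases ?_ (fun k => ?_) k
    · rw [Fin.cons_zero]
      exact continuous_zigzag
    · exact (lipschitzWith_single _).continuous.comp (continuous_sweep hr hq)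

section ZigzagAlgorithm

variable {q l : ℕ} {hq : 1 ≤ q} {r : ℝ} {hr : 1 < r}

theorem zigzagAlgorithm_position_zero : (zigzagAlgorithm q l hq hr).position 0 =
    zigzag r q fun i => Fin.castAdd l ⟨i % q, Nat.mod_lt i hq⟩ := by
  rw [zigzagAlgorithm]
  simp only [Fin.cons_zero]

theorem zigzagAlgorithm_position_succ (k : Fin l) :
    (zigzagAlgorithm q l hq hr).position k.succ =
      fun t => PiLp.single 1 (Fin.natAdd q k) (sweep r q t) := by
  rw [zigzagAlgorithm]
  simp only [Fin.cons_succ]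

theorem travelled_zigzagAlgorithm_le (i : ℕ) {t : ℝ≥0} (hit : (i : ℝ≥0) ≤ t) (hti : t ≤ i + 1) :
    (zigzagAlgorithm q l hq hr).travelled t ≤ ENNReal.ofReal
      (2 * (r ^ q / (r - 1)) * r ^ i + 2 * r ^ (i + q) * (t - i) + l * sweep r q t) := by
  have hr1 : 0 < r - 1 := by linarith
  have hit' : (0 : ℝ) ≤ t - i := by
    have : (i : ℝ) ≤ t := by exact_mod_cast hit
    linarith
  have hs := sweep_nonneg (q := q) hr t
  rw [ExplorationAlgorithm.travelled, Fin.sum_univ_succ, zigzagAlgorithm_position_zero,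
    ENNReal.ofReal_add (by positivity) (by positivity)]
  refine add_le_add (eVariationOn_zigzag_le hr i hit hti) ?_
  rw [ENNReal.ofReal_mul (by positivity), ENNReal.ofReal_natCast, ← nsmul_eq_mul]
  refine (Finset.sum_le_card_nsmul _ _ (ENNReal.ofReal (sweep r q t)) fun k _ => ?_).trans
    (by simp)
  rw [zigzagAlgorithm_position_succ]
  exact eVariationOn_single_le (monotone_sweep hr) (sweep_zero hr) _ t

theorem goalCost_zigzagAlgorithm_castAdd_le (j : Fin q) {n : ℝ} (hn : 0 < n) :
    (zigzagAlgorithm q l hq hr).goalCost (Fin.castAdd l j) n ≤ ENNReal.ofReal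
      ((l + 1 + 2 * (r ^ q / (r - 1))) * n + (2 * (r ^ q / (r - 1)) + l + 1) * r ^ q) := by
  have hr1 : 0 < r - 1 := by linarith
  have hex : ∃ s : ℕ, n ≤ r ^ (j + q * s + q) := by
    obtain ⟨N, hN⟩ := pow_unbounded_of_one_lt n hr
    refine ⟨N, hN.le.trans (pow_le_pow_right₀ hr.le ?_)⟩
    nlinarith
  -- The first phase on path `j` that gets as far as `n`. The previous visit, `q` phases earlier,
  -- turned at `r ^ i`, so `r ^ i < n`; if there was none, `i < q` and `r ^ q` dominates.
  obtain ⟨i, hij, hni, hi⟩ : ∃ i : ℕ, i % q = j ∧ n ≤ r ^ (i + q) ∧ r ^ i ≤ n + r ^ q := by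
    classical
    refine ⟨j + q * Nat.find hex, ?_, Nat.find_spec hex, ?_⟩
    · rw [Nat.add_mul_mod_self_left, Nat.mod_eq_of_lt j.2]
    · rcases hs : Nat.find hex with _ | s
      · have : r ^ (j + q * 0) ≤ r ^ q := pow_le_pow_right₀ hr.le (by have := j.2; omega)
        linarith
      · have h1 := Nat.find_min hex (m := s) (by omega)
        rw [mul_add, mul_one, ← add_assoc]
        have h2 : 0 ≤ r ^ q := by positivity
        linarith
  have hpos : 0 < r ^ (i + q) := by positivity
  set u : ℝ := n / (2 * r ^ (i + q)) with hu
  have hu0 : 0 ≤ u := by positivity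
  have hXu : 2 * r ^ (i + q) * u = n := by rw [hu]; field_simp
  have hu1 : 2 * u ≤ 1 := by
    have : r ^ (i + q) * (2 * u) ≤ r ^ (i + q) * 1 := by linarith
    exact le_of_mul_le_mul_left this hpos
  set t : ℝ≥0 := i + u.toNNReal with ht
  have htu : (t : ℝ) - i = u := by
    rw [ht]
    push_cast
    rw [Real.coe_toNNReal _ hu0]
    ring
  have hti : t < i + 1 := by
    rw [← NNReal.coe_lt_coe]
    push_cast
    linarith
  have hfl : ⌊t⌋₊ = i := (Nat.floor_eq_iff zero_le).2 ⟨by simp [ht], hti⟩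
  have hreach : (zigzagAlgorithm q l hq hr).Reaches (Fin.castAdd l j) n t := by
    refine ⟨0, ?_⟩
    rw [zigzagAlgorithm_position_zero, zigzag, hfl, tent, htu, min_eq_left (by linarith),
      max_eq_right (by linarith)]
    simp only [hij, Fin.eta, PiLp.single_eq_same]
    linarith
  refine (iInf₂_le t hreach).trans ((travelled_zigzagAlgorithm_le i (by simp [ht]) hti.le).trans
    (ENNReal.ofReal_le_ofReal ?_))
  have hrq : 0 < r ^ q := by positivity
  have hsw : sweep r q t ≤ n + r ^ q := by
    rw [sweep, hfl, ramp, htu, hXu]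
    have := max_le hi ((min_le_right (r ^ (i + 1)) n).trans (by linarith : n ≤ n + r ^ q))
    linarith
  rw [htu, hXu]
  have h1 : 2 * (r ^ q / (r - 1)) * r ^ i ≤ 2 * (r ^ q / (r - 1)) * (n + r ^ q) := by gcongr
  have h2 : (l : ℝ) * sweep r q t ≤ l * (n + r ^ q) := by gcongr
  linarith

theorem goalCost_zigzagAlgorithm_natAdd_le (k : Fin l) {n : ℝ} (hn : 0 < n) :
    (zigzagAlgorithm q l hq hr).goalCost (Fin.natAdd q k) n ≤ ENNReal.ofReal
      ((l + 1 + 2 * (r ^ q / (r - 1))) * n + (2 * (r ^ q / (r - 1)) + l + 1) * r ^ q) := by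
  have hr1 : 0 < r - 1 := by linarith
  obtain ⟨i, hin, hni⟩ := exists_nat_pow_near (by linarith : 1 ≤ n + 1) hr
  have hpos : 0 < r ^ (i + q) := by positivity
  have hle : r ^ (i + 1) ≤ r ^ (i + q) := pow_le_pow_right₀ hr.le (by omega)
  -- The shift by `1` compensates the `- 1` in `ramp`, so that the sweep is exactly at `n`.
  set u : ℝ := (n + 1) / (2 * r ^ (i + q)) with hu
  have hu0 : 0 ≤ u := by positivity
  have hXu : 2 * r ^ (i + q) * u = n + 1 := by rw [hu]; field_simp
  have hu1 : 2 * u ≤ 1 := by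
    have : r ^ (i + q) * (2 * u) ≤ r ^ (i + q) * 1 := by linarith
    exact le_of_mul_le_mul_left this hpos
  set t : ℝ≥0 := i + u.toNNReal with ht
  have htu : (t : ℝ) - i = u := by
    rw [ht]
    push_cast
    rw [Real.coe_toNNReal _ hu0]
    ring
  have hti : t < i + 1 := by
    rw [← NNReal.coe_lt_coe]
    push_cast
    linarith
  have hfl : ⌊t⌋₊ = i := (Nat.floor_eq_iff zero_le).2 ⟨by simp [ht], hti⟩
  have hsw : sweep r q t = n := by
    rw [sweep, hfl, ramp, htu, hXu, min_eq_right hni.le, max_eq_right hin]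
    ring
  have hreach : (zigzagAlgorithm q l hq hr).Reaches (Fin.natAdd q k) n t := by
    refine ⟨k.succ, ?_⟩
    rw [zigzagAlgorithm_position_succ, PiLp.single_eq_same, hsw]
  refine (iInf₂_le t hreach).trans ((travelled_zigzagAlgorithm_le i (by simp [ht]) hti.le).trans
    (ENNReal.ofReal_le_ofReal ?_))
  rw [htu, hXu, hsw]
  have hrq : 1 ≤ r ^ q := one_le_pow₀ hr.le
  have hM : 0 ≤ 2 * (r ^ q / (r - 1)) := by positivity
  have h1 := mul_le_mul_of_nonneg_left hin hM
  have h2 := mul_le_mul_of_nonneg_left hrq (by positivity : 0 ≤ 2 * (r ^ q / (r - 1)) + l + 1)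
  have h3 : (0 : ℝ) ≤ l := by positivity
  linarith

theorem hasCompetitiveRatio_zigzagAlgorithm :
    (zigzagAlgorithm q l hq hr).HasCompetitiveRatio (l + 1 + 2 * (r ^ q / (r - 1))) := by
  refine ⟨fun _ => (2 * (r ^ q / (r - 1)) + l + 1) * r ^ q,
    Asymptotics.isLittleO_const_id_atTop _, fun n hn => iSup_le fun p => ?_⟩
  refine Fin.addCases (fun j => ?_) (fun k => ?_) p
  · exact goalCost_zigzagAlgorithm_castAdd_le j hn
  · exact goalCost_zigzagAlgorithm_natAdd_le k hn

end ZigzagAlgorithm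

theorem mem_competitiveRatios_of_lt {w l : ℕ} (hl : 1 ≤ l) (hlw : l < w) :
    (l : ℝ) + 2 * (((w : ℝ) - l + 1) ^ (w - l + 1) / ((w : ℝ) - l) ^ (w - l)) ∈
      competitiveRatios w l := by
  obtain ⟨l, rfl⟩ := Nat.exists_eq_add_of_le' hl
  obtain ⟨m, rfl⟩ := Nat.exists_eq_add_of_le' hlw.le
  have hm : 1 ≤ m := by omega
  have hm0 : (0 : ℝ) < m := by exact_mod_cast hm
  rw [← add_assoc, add_right_comm]
  have hr : (1 : ℝ) < (m + 1) / m := by rw [lt_div_iff₀ hm0]; linarith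
  refine ⟨zigzagAlgorithm (m + 1) l (by omega) hr, ?_⟩
  convert hasCompetitiveRatio_zigzagAlgorithm using 1
  rw [show m + 1 + l - (l + 1) = m by omega]
  push_cast
  rw [show (m : ℝ) + 1 + l - (l + 1) = m by ring, div_pow, pow_succ (m : ℝ) m]
  field_simp
  ring

/-- Every robot walks on a path of its own. -/
noncomputable def parallelAlgorithm (w : ℕ) : ExplorationAlgorithm w w where
  position k t := PiLp.single 1 k (t : ℝ)
  position_mem_star k t := single_mem_pathStar k t.2
  position_zero k := by simp
  continuous_position k := (lipschitzWith_single k).continuous.comp NNReal.continuous_coe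

theorem natCast_mem_competitiveRatios (w : ℕ) : (w : ℝ) ∈ competitiveRatios w w := by
  refine ⟨parallelAlgorithm w, fun _ => 0, Asymptotics.isLittleO_const_id_atTop _,
    fun n hn => iSup_le fun p => ?_⟩
  have hreach : (parallelAlgorithm w).Reaches p n n.toNNReal :=
    ⟨p, by simp [parallelAlgorithm, hn.le]⟩
  refine (iInf₂_le _ hreach).trans ?_
  rw [add_zero, ENNReal.ofReal_mul (by positivity), ENNReal.ofReal_natCast, ← nsmul_eq_mul]
  refine (Finset.sum_le_card_nsmul _ _ (ENNReal.ofReal n) fun k _ => ?_).trans (by simp)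
  refine (eVariationOn_single_le NNReal.coe_mono NNReal.coe_zero k _).trans ?_
  rw [Real.coe_toNNReal _ hn.le]

theorem theorem1 (w l : ℕ) (hl : 1 ≤ l) :
    (l < w → IsLeast (competitiveRatios w l)
      ((l : ℝ) + 2 * (((w : ℝ) - l + 1) ^ (w - l + 1) / ((w : ℝ) - l) ^ (w - l)))) ∧
    (l = w → IsLeast (competitiveRatios w l) (w : ℝ)) := by
  refine ⟨fun hlw => ⟨mem_competitiveRatios_of_lt hl hlw, ?_⟩, ?_⟩
  · rintro c ⟨A, hA⟩
    exact hA.le_of_lt hlw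
  · rintro rfl
    refine ⟨natCast_mem_competitiveRatios l, ?_⟩
    rintro c ⟨A, hA⟩
    exact hA.le_of_eq hl
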